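/- Let $n,p$ be integers with $n-p-1>0$, let $M\in\mathbb{R}^{n\times p}$, and let $X\in\mathbb{R}^{n\times p}$ be a random matrix with independent entries $X_{ij}\sim \mathrm{N}(M_{ij},1)$. Let $$\hat M_{\mathrm{EM}} = X\bigl(I_p-(n-p-1)(X^\top X)^{-1}\bigr)$$ be the Efron--Morris estimator and let $$R(M)=\mathrm{E}_M\bigl[(\hat M_{\mathrm{EM}}-M)^\top(\hat M_{\mathrm{EM}}-M)\bigr]\in\mathbb{R}^{p\times p}$$ be its matrix quadratic risk (the expectation is taken entrywise). Then the expectation is finite, and $R(M)$ has the same eigenvectors as $M^\top M$ in the following sense: for every spectral decomposition $M^\top M=U^\top\Lambda U$ with $U$ orthogonal and $\Lambda=\mathrm{diag}(\lambda_1,\dots,\lambda_p)$, there are real numbers $\rho_1,\dots,\rho_p$ with $$R(M)=U^\top\,\mathrm{diag}(\rho_1,\dots,\rho_p)\,U ,$$ and $\rho_j=p+1$ for every $j$ with $\lambda_j=0$. In particular, every eigenvector $v$ of $M^\top M$ is an eigenvector of $R(M)$, and if $M^\top M v=0$, then $R(M)v=(p+1)v$. -/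

import Mathlib

open MeasureTheory ProbabilityTheory Matrix

noncomputable section

namespace EfronMorris

/-- `X` is a random `n × p` matrix whose entries are independent with `X i j ∼ N(M i j, 1)`. -/
structure IsNormalMatrixObservation {Ω : Type*} [MeasurableSpace Ω] {n p : ℕ}
    (P : Measure Ω) (M : Matrix (Fin n) (Fin p) ℝ) (X : Ω → Matrix (Fin n) (Fin p) ℝ) :
    Prop where
  hasLaw : ∀ i j, HasLaw (fun ω => X ω i j) (gaussianReal (M i j) 1) P
  indep : iIndepFun (fun (ij : Fin n × Fin p) (ω : Ω) => X ω ij.1 ij.2) P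

/-- The Efron–Morris estimator `X (I - (n - p - 1) (XᵀX)⁻¹)`. -/
def estimator {n p : ℕ} (X : Matrix (Fin n) (Fin p) ℝ) : Matrix (Fin n) (Fin p) ℝ :=
  X * (1 - ((n : ℝ) - (p : ℝ) - 1) • (Xᵀ * X)⁻¹)

/-- The matrix quadratic loss `(M' - M)ᵀ (M' - M)` of the estimate `M'` of `M`. -/
def loss {n p : ℕ} (M M' : Matrix (Fin n) (Fin p) ℝ) : Matrix (Fin p) (Fin p) ℝ :=
  (M' - M)ᵀ * (M' - M)

/-- The matrix quadratic risk of the estimator `δ` of `M` based on the observation `X`: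
the entrywise expectation of the matrix quadratic loss. -/
def risk {Ω : Type*} [MeasurableSpace Ω] {n p : ℕ} (P : Measure Ω)
    (M : Matrix (Fin n) (Fin p) ℝ) (X : Ω → Matrix (Fin n) (Fin p) ℝ)
    (δ : Matrix (Fin n) (Fin p) ℝ → Matrix (Fin n) (Fin p) ℝ) : Matrix (Fin p) (Fin p) ℝ :=
  Matrix.of fun a b => ∫ ω, loss M (δ (X ω)) a b ∂P

end EfronMorris

end

/-!
For an orthogonally equivariant estimator `δ`, rotating the observation `X` to `O * X * Q` turns the
risk `R(M)` into `R(O * M * Q) = Qᵀ * R(M) * Q`. If `Mᵀ * M * u = c • u`, then the Householder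
reflections `H_{Mu}` and `H_u` satisfy `H_{Mu} * M * H_u = M`; hence `R(M)` commutes with `H_u`, and
`u` is an eigenvector of `R(M)`.

If moreover `M * u = 0`, rotate `u` onto a coordinate axis, so that column `a` of `M` vanishes. The
entry `(XᵀX)⁻¹ a a` is the inverse squared distance of column `a` of `X` to the span of the other
columns. Conditionally on these, the squared distance is a chi-squared variable with `n - p + 1`
degrees of freedom, so the entry has mean `1 / (n - p - 1)`, and expanding the loss gives
`R(M) a a = n - 2 * (n - p - 1) + (n - p - 1) = p + 1`.

For a general mean the chi-squared variable is noncentral, and its Laplace transform is dominated by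
the central one. This bounds the mean of `(XᵀX)⁻¹ a a` by the same constant, and integrability of
the loss follows from `∑ i, (X * (XᵀX)⁻¹) i a ^ 2 = (XᵀX)⁻¹ a a`.
-/

namespace EfronMorris

open Filter Module Set
open WithLp (toLp)
open scoped InnerProductSpace Kronecker

section StandardCovariance

variable {ι κ : Type*} [Fintype ι] [DecidableEq ι] [Fintype κ] [DecidableEq κ]

theorem charFun_multivariateGaussian_one (m t : EuclideanSpace ℝ ι) :
    charFun (multivariateGaussian m 1) t =
      Complex.exp ((⟪t, m⟫_ℝ : ℂ) * Complex.I - (‖t‖ : ℂ) ^ 2 / 2) := by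
  rw [charFun_multivariateGaussian PosSemidef.one, one_mulVec, ← Complex.ofReal_pow,
    EuclideanSpace.real_norm_sq_eq]
  simp only [dotProduct, sq]

theorem map_pi_gaussianReal_toLp (m : ι → ℝ) :
    (Measure.pi fun i => gaussianReal (m i) 1).map (toLp 2) =
      multivariateGaussian (toLp 2 m) 1 := by
  refine Measure.ext_of_charFun (E := EuclideanSpace ℝ ι) (funext fun t => ?_)
  simp only [charFun_multivariateGaussian_one, charFun_pi, charFun_gaussianReal,
    ← Complex.exp_sum, ← Complex.ofReal_pow, EuclideanSpace.real_norm_sq_eq, PiLp.inner_apply]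
  simp [Finset.sum_sub_distrib, Finset.sum_div, Finset.mul_sum, mul_comm]

theorem map_multivariateGaussian_one {L : EuclideanSpace ℝ ι →L[ℝ] EuclideanSpace ℝ κ}
    (hL : L ∘L L.adjoint = .id ℝ _) (m : EuclideanSpace ℝ ι) :
    (multivariateGaussian m 1).map L = multivariateGaussian (L m) 1 := by
  refine Measure.ext_of_charFun (funext fun t => ?_)
  have hnorm : ‖L.adjoint t‖ = ‖t‖ := by
    rw [← sq_eq_sq₀ (norm_nonneg _) (norm_nonneg _), ← real_inner_self_eq_norm_sq,
      ← real_inner_self_eq_norm_sq, ContinuousLinearMap.adjoint_inner_left,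
      ← ContinuousLinearMap.comp_apply, hL, ContinuousLinearMap.id_apply]
  have hchar : charFun ((multivariateGaussian m 1).map L) t =
      charFun (multivariateGaussian m 1) (L.adjoint t) := by
    rw [charFun_apply, charFun_apply, integral_map (by fun_prop) (by fun_prop)]
    simp only [ContinuousLinearMap.adjoint_inner_right]
  rw [hchar, charFun_multivariateGaussian_one, charFun_multivariateGaussian_one, hnorm,
    ContinuousLinearMap.adjoint_inner_left]

theorem measurePreserving_mulVec_pi_gaussianReal {A : Matrix ι ι ℝ}
    (hA : A ∈ orthogonalGroup ι ℝ) (m : ι → ℝ) :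
    MeasurePreserving (A *ᵥ ·) (Measure.pi fun i => gaussianReal (m i) 1)
      (Measure.pi fun i => gaussianReal ((A *ᵥ m) i) 1) := by
  have htoLp (m : ι → ℝ) : MeasurePreserving (MeasurableEquiv.toLp 2 (ι → ℝ))
      (Measure.pi fun i => gaussianReal (m i) 1) (multivariateGaussian (toLp 2 m) 1) :=
    ⟨MeasurableEquiv.measurable _, map_pi_gaussianReal_toLp m⟩
  have hcomp : toEuclideanCLM (𝕜 := ℝ) A ∘L (toEuclideanCLM (𝕜 := ℝ) A).adjoint = .id ℝ _ := by
    rw [← ContinuousLinearMap.star_eq_adjoint, ← map_star, ← ContinuousLinearMap.mul_def,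
      ← map_mul, mem_unitaryGroup_iff.1 hA, map_one, ContinuousLinearMap.one_def]
  have hrot : MeasurePreserving (toEuclideanCLM (𝕜 := ℝ) A)
      (multivariateGaussian (toLp 2 m) 1) (multivariateGaussian (toLp 2 (A *ᵥ m)) 1) :=
    ⟨by fun_prop, map_multivariateGaussian_one hcomp _⟩
  exact (htoLp _).symm.comp (hrot.comp (htoLp m))

theorem multivariateGaussian_submodule {S : Matrix ι ι ℝ} (hS : S.PosDef)
    (m : EuclideanSpace ℝ ι) {K : Submodule ℝ (EuclideanSpace ℝ ι)} (hK : K ≠ ⊤) :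
    multivariateGaussian m S (K : Set (EuclideanSpace ℝ ι)) = 0 := by
  obtain ⟨w, hwK, hw⟩ := Kᗮ.exists_mem_ne_zero_of_ne_bot (mt K.orthogonal_eq_bot_iff.1 hK)
  have hvar : 0 < Var[innerSL ℝ w; multivariateGaussian m S] := by
    have hpos := hS.dotProduct_mulVec_pos (x := w.ofLp) (by simpa using hw)
    rw [star_trivial, ← covarianceBilin_multivariateGaussian (μ := m) hS.posSemidef,
      covarianceBilin_self IsGaussian.memLp_two_id] at hpos
    exact hpos
  have : NullSingletonClass (gaussianReal (multivariateGaussian m S)[innerSL ℝ w]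
      Var[innerSL ℝ w; multivariateGaussian m S].toNNReal) :=
    nullSingletonClass_gaussianReal (Real.toNNReal_pos.2 hvar).ne'
  have hlevel : multivariateGaussian m S (innerSL ℝ w ⁻¹' {0}) = 0 := by
    rw [← Measure.map_apply (by fun_prop) (measurableSet_singleton 0),
      IsGaussian.map_eq_gaussianReal, measure_singleton]
  exact measure_mono_null (fun x hx => K.inner_left_of_mem_orthogonal hx hwK) hlevel

end StandardCovariance

section LinearIndependence

theorem measurePreserving_insertNth {E : Type*} [MeasurableSpace E] {q : ℕ}
    (μ : Fin (q + 1) → Measure E) [∀ j, SigmaFinite (μ j)] (a : Fin (q + 1)) :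
    MeasurePreserving (fun z : (Fin q → E) × E => (a.insertNth z.2 z.1 : Fin (q + 1) → E))
      ((Measure.pi fun j => μ (a.succAbove j)).prod (μ a)) (Measure.pi μ) :=
  (measurePreserving_piFinSuccAbove μ a).symm.comp Measure.measurePreserving_swap

theorem ae_linearIndependent_pi {𝕜 E : Type*} [NontriviallyNormedField 𝕜] [CompleteSpace 𝕜]
    [NormedAddCommGroup E] [NormedSpace 𝕜 E] [SecondCountableTopology E] [MeasurableSpace E]
    [BorelSpace E] {q : ℕ} (hq : q ≤ finrank 𝕜 E) (μ : Fin q → Measure E)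
    [∀ j, SigmaFinite (μ j)] (hμ : ∀ j (K : Submodule 𝕜 E), K ≠ ⊤ → μ j (K : Set E) = 0) :
    ∀ᵐ v ∂Measure.pi μ, LinearIndependent 𝕜 v := by
  induction q with
  | zero => exact Eventually.of_forall fun _ => linearIndependent_empty_type
  | succ q ih =>
    have hins := measurePreserving_insertNth μ 0
    have hmeas : MeasurableSet {v : Fin (q + 1) → E | LinearIndependent 𝕜 v} :=
      isOpen_setOfPred_linearIndependent.measurableSet
    rw [← hins.map_eq, ae_map_iff hins.measurable.aemeasurable hmeas]
    refine (Measure.ae_prod_iff_ae_ae (hins.measurable hmeas)).2 ?_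
    filter_upwards [ih (by omega) _ fun j => hμ _] with v hv
    have hspan : Submodule.span 𝕜 (range v) ≠ ⊤ := fun htop => by
      have hcard := finrank_range_le_card (R := 𝕜) v
      rw [Set.finrank, htop, finrank_top, Fintype.card_fin] at hcard
      omega
    filter_upwards [compl_mem_ae_iff.2 (hμ 0 _ hspan)] with x hx
    rw [Fin.insertNth_zero']
    exact linearIndependent_finCons.2 ⟨hv, hx⟩

end LinearIndependence

section InverseSquareNorm

theorem gaussianPDFReal_mul_exp_neg_mul_sq (μ x : ℝ) {t : ℝ} (ht : 0 < t) :
    gaussianPDFReal μ 1 x * Real.exp (-((t - 1) * (x ^ 2 / 2))) =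
      (√t)⁻¹ * Real.exp (-((t - 1) * μ ^ 2 / (2 * t))) *
        gaussianPDFReal (μ / t) (t⁻¹).toNNReal x := by
  have hsquare : -(x - μ) ^ 2 / 2 + -((t - 1) * (x ^ 2 / 2)) =
      -((t - 1) * μ ^ 2 / (2 * t)) + -(x - μ / t) ^ 2 / (2 * t⁻¹) := by
    field_simp
    ring
  have hsqrt : (√(2 * Real.pi))⁻¹ = (√t)⁻¹ * (√(2 * Real.pi * t⁻¹))⁻¹ := by
    rw [← mul_inv, ← Real.sqrt_mul ht.le, mul_left_comm, mul_inv_cancel₀ ht.ne', mul_one]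
  simp only [gaussianPDFReal, NNReal.coe_one, mul_one, Real.coe_toNNReal _ (inv_nonneg.2 ht.le)]
  rw [mul_assoc, ← Real.exp_add, hsquare, Real.exp_add, hsqrt]
  ring

theorem integral_exp_neg_mul_sq_gaussianReal (μ : ℝ) {t : ℝ} (ht : 0 < t) :
    ∫ x, Real.exp (-((t - 1) * (x ^ 2 / 2))) ∂gaussianReal μ 1 =
      (√t)⁻¹ * Real.exp (-((t - 1) * μ ^ 2 / (2 * t))) := by
  simp only [integral_gaussianReal_eq_integral_smul one_ne_zero, smul_eq_mul,
    gaussianPDFReal_mul_exp_neg_mul_sq μ _ ht]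
  rw [integral_const_mul, integral_gaussianPDFReal_eq_one _ (by simpa using ht), mul_one]

variable {ι : Type*} [Fintype ι] [DecidableEq ι]

theorem integral_exp_neg_mul_norm_sq_multivariateGaussian (m : EuclideanSpace ℝ ι) {t : ℝ}
    (ht : 0 < t) :
    ∫ x, Real.exp (-((t - 1) * (‖x‖ ^ 2 / 2))) ∂multivariateGaussian m 1 =
      t ^ (-(Fintype.card ι / 2 : ℝ)) * Real.exp (-((t - 1) * ‖m‖ ^ 2 / (2 * t))) := by
  have hprod (x : ι → ℝ) : Real.exp (-((t - 1) * (‖toLp 2 x‖ ^ 2 / 2))) =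
      ∏ i, Real.exp (-((t - 1) * (x i ^ 2 / 2))) := by
    rw [EuclideanSpace.real_norm_sq_eq, ← Real.exp_sum, Finset.sum_neg_distrib, Finset.sum_div,
      Finset.mul_sum]
  have hpow : (√t)⁻¹ ^ Fintype.card ι = t ^ (-(Fintype.card ι / 2 : ℝ)) := by
    rw [Real.sqrt_eq_rpow, ← Real.rpow_neg ht.le, ← Real.rpow_natCast, ← Real.rpow_mul ht.le]
    congr 1
    ring
  rw [← WithLp.toLp_ofLp 2 m, ← map_pi_gaussianReal_toLp, integral_map (by fun_prop) (by fun_prop)]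
  simp only [hprod]
  rw [integral_fintype_prod_eq_prod (f := fun _ x => Real.exp (-((t - 1) * (x ^ 2 / 2))))]
  simp only [integral_exp_neg_mul_sq_gaussianReal _ ht]
  rw [Finset.prod_mul_distrib, Finset.prod_const, Finset.card_univ, hpow, ← Real.exp_sum,
    Finset.sum_neg_distrib, ← Finset.sum_div, ← Finset.mul_sum, WithLp.toLp_ofLp,
    EuclideanSpace.real_norm_sq_eq]

-- Starting the integral at `1` makes the Gaussian expectation of the integrand a pure power of `t`
-- when the mean vanishes.
theorem inv_ofReal_eq_lintegral_exp {q : ℝ} (hq : 0 ≤ q) :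
    (ENNReal.ofReal q)⁻¹ =
      2⁻¹ * ∫⁻ t in Ioi (1 : ℝ), ENNReal.ofReal (Real.exp (-((t - 1) * (q / 2)))) := by
  rcases hq.eq_or_lt with rfl | hq
  · simp
  have hneg : -(q / 2) < 0 := by linarith
  have hshift (t : ℝ) :
      Real.exp (-((t - 1) * (q / 2))) = Real.exp (q / 2) * Real.exp (-(q / 2) * t) := by
    rw [← Real.exp_add]
    ring_nf
  have hint : ∫ t in Ioi (1 : ℝ), Real.exp (q / 2) * Real.exp (-(q / 2) * t) = 2 * q⁻¹ := by
    rw [integral_const_mul, integral_exp_mul_Ioi hneg, neg_div_neg_eq, mul_one, mul_div_assoc',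
      ← Real.exp_add, add_neg_cancel, Real.exp_zero, one_div_div, div_eq_mul_inv]
  simp only [hshift]
  rw [← ofReal_integral_eq_lintegral_ofReal ((integrableOn_exp_mul_Ioi hneg 1).const_mul _)
    (.of_forall fun t => by positivity), hint, ENNReal.ofReal_mul zero_le_two,
    ENNReal.ofReal_inv_of_pos hq, ENNReal.ofReal_ofNat,
    ENNReal.inv_mul_cancel_left two_ne_zero ENNReal.ofNat_ne_top]

theorem lintegral_inv_norm_sq_multivariateGaussian (m : EuclideanSpace ℝ ι) :
    ∫⁻ x, (ENNReal.ofReal (‖x‖ ^ 2))⁻¹ ∂multivariateGaussian m 1 =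
      2⁻¹ * ∫⁻ t in Ioi (1 : ℝ), ENNReal.ofReal
        (t ^ (-(Fintype.card ι / 2 : ℝ)) * Real.exp (-((t - 1) * ‖m‖ ^ 2 / (2 * t)))) := by
  simp only [inv_ofReal_eq_lintegral_exp (sq_nonneg _)]
  rw [lintegral_const_mul _ (by fun_prop), lintegral_lintegral_swap (by fun_prop)]
  congr 1
  refine setLIntegral_congr_fun measurableSet_Ioi fun t (ht : 1 < t) => ?_
  have hbound (x : EuclideanSpace ℝ ι) : ‖Real.exp (-((t - 1) * (‖x‖ ^ 2 / 2)))‖ ≤ 1 := by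
    rw [Real.norm_of_nonneg (Real.exp_nonneg _), Real.exp_le_one_iff, neg_nonpos]
    exact mul_nonneg (by linarith) (by positivity)
  rw [← ofReal_integral_eq_lintegral_ofReal (.of_bound (by fun_prop) 1 (.of_forall hbound))
    (.of_forall fun x => Real.exp_nonneg _),
    integral_exp_neg_mul_norm_sq_multivariateGaussian m (by linarith)]

theorem lintegral_Ioi_one_rpow_neg_div_two {s : ℝ} (hs : 2 < s) :
    2⁻¹ * ∫⁻ t in Ioi (1 : ℝ), ENNReal.ofReal (t ^ (-(s / 2))) = ENNReal.ofReal (s - 2)⁻¹ := by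
  rw [← ofReal_integral_eq_lintegral_ofReal (integrableOn_Ioi_rpow_of_lt (by linarith) one_pos)
    ((ae_restrict_mem measurableSet_Ioi).mono fun t (ht : 1 < t) => by positivity),
    integral_Ioi_rpow_of_lt (by linarith) one_pos, Real.one_rpow, ← ENNReal.ofReal_ofNat,
    ← ENNReal.ofReal_inv_of_pos two_pos, ← ENNReal.ofReal_mul (by positivity)]
  congr 1
  rw [← mul_div_assoc, ← inv_div, ← one_div]
  ring

theorem lintegral_inv_norm_sq_multivariateGaussian_le (hι : 2 < Fintype.card ι)
    (m : EuclideanSpace ℝ ι) :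
    ∫⁻ x, (ENNReal.ofReal (‖x‖ ^ 2))⁻¹ ∂multivariateGaussian m 1 ≤
      ENNReal.ofReal ((Fintype.card ι - 2 : ℝ)⁻¹) := by
  rw [lintegral_inv_norm_sq_multivariateGaussian,
    ← lintegral_Ioi_one_rpow_neg_div_two (by exact_mod_cast hι)]
  gcongr 2⁻¹ * ?_
  refine setLIntegral_mono (by fun_prop) fun t (ht : 1 < t) => ENNReal.ofReal_le_ofReal ?_
  refine mul_le_of_le_one_right (by positivity) (Real.exp_le_one_iff.2 (neg_nonpos.2 ?_))
  exact div_nonneg (mul_nonneg (by linarith) (sq_nonneg _)) (by linarith)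

theorem lintegral_inv_norm_sq_multivariateGaussian_zero (hι : 2 < Fintype.card ι) :
    ∫⁻ x : EuclideanSpace ℝ ι, (ENNReal.ofReal (‖x‖ ^ 2))⁻¹ ∂multivariateGaussian 0 1 =
      ENNReal.ofReal ((Fintype.card ι - 2 : ℝ)⁻¹) := by
  rw [lintegral_inv_norm_sq_multivariateGaussian,
    ← lintegral_Ioi_one_rpow_neg_div_two (by exact_mod_cast hι)]
  simp

end InverseSquareNorm

section Projection

variable {ι : Type*} [Fintype ι] [DecidableEq ι]

theorem exists_map_multivariateGaussian_one_norm_starProjection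
    (K : Submodule ℝ (EuclideanSpace ℝ ι)) (m : EuclideanSpace ℝ ι) :
    ∃ L : EuclideanSpace ℝ ι →L[ℝ] EuclideanSpace ℝ (Fin (finrank ℝ K)),
      (multivariateGaussian m 1).map L = multivariateGaussian (L m) 1 ∧
        ∀ x, ‖L x‖ = ‖K.starProjection x‖ := by
  let e := (stdOrthonormalBasis ℝ K).repr
  let L := e.toContinuousLinearEquiv.toContinuousLinearMap ∘L K.orthogonalProjectionOnto
  have hadj : L.adjoint = K.subtypeL ∘L e.symm.toContinuousLinearEquiv.toContinuousLinearMap := by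
    refine ((ContinuousLinearMap.eq_adjoint_iff _ _).2 fun y x => ?_).symm
    change ⟪(e.symm y : EuclideanSpace ℝ ι), x⟫_ℝ = ⟪y, e (K.orthogonalProjectionOnto x)⟫_ℝ
    rw [← Submodule.inner_orthogonalProjectionOnto_eq_of_mem_left, e.symm.inner_map_eq_flip,
      e.symm_symm]
  refine ⟨L, map_multivariateGaussian_one (ContinuousLinearMap.ext fun y => ?_) m, fun x => ?_⟩
  · rw [hadj]
    change e (K.orthogonalProjectionOnto (e.symm y : EuclideanSpace ℝ ι)) = y
    rw [Submodule.orthogonalProjectionOnto_mem_subspace_eq_self, e.apply_symm_apply]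
  · exact e.norm_map _

theorem lintegral_inv_norm_sq_starProjection_le {K : Submodule ℝ (EuclideanSpace ℝ ι)}
    (hK : 2 < finrank ℝ K) (m : EuclideanSpace ℝ ι) :
    ∫⁻ x, (ENNReal.ofReal (‖K.starProjection x‖ ^ 2))⁻¹ ∂multivariateGaussian m 1 ≤
      ENNReal.ofReal ((finrank ℝ K - 2 : ℝ)⁻¹) := by
  obtain ⟨L, hL, hnorm⟩ := exists_map_multivariateGaussian_one_norm_starProjection K m
  simp only [← hnorm]
  rw [← lintegral_map (f := fun y => (ENNReal.ofReal (‖y‖ ^ 2))⁻¹) (by fun_prop) (by fun_prop), hL]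
  simpa using lintegral_inv_norm_sq_multivariateGaussian_le (by simpa using hK) (L m)

theorem lintegral_inv_norm_sq_starProjection_zero {K : Submodule ℝ (EuclideanSpace ℝ ι)}
    (hK : 2 < finrank ℝ K) :
    ∫⁻ x, (ENNReal.ofReal (‖K.starProjection x‖ ^ 2))⁻¹ ∂multivariateGaussian 0 1 =
      ENNReal.ofReal ((finrank ℝ K - 2 : ℝ)⁻¹) := by
  obtain ⟨L, hL, hnorm⟩ := exists_map_multivariateGaussian_one_norm_starProjection K 0
  simp only [← hnorm]
  rw [← lintegral_map (f := fun y => (ENNReal.ofReal (‖y‖ ^ 2))⁻¹) (by fun_prop) (by fun_prop), hL,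
    map_zero]
  simpa using lintegral_inv_norm_sq_multivariateGaussian_zero (ι := Fin (finrank ℝ K))
    (by simpa using hK)

end Projection

section Gram

variable {E : Type*} [NormedAddCommGroup E] [InnerProductSpace ℝ E] {κ : Type*}
  [Fintype κ] [DecidableEq κ]

theorem inner_sum_inv_gram_smul {v : κ → E} (hv : LinearIndependent ℝ v) (a b : κ) :
    ⟪v b, ∑ j, (gram ℝ v)⁻¹ j a • v j⟫_ℝ = (1 : Matrix κ κ ℝ) b a := by
  have hunit : IsUnit (gram ℝ v).det := (det_gram_ne_zero_iff_linearIndependent.2 hv).isUnit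
  rw [← mul_nonsing_inv _ hunit, Matrix.mul_apply, inner_sum]
  simp only [inner_smul_right, gram_apply, mul_comm]

theorem inv_gram_apply_self {v : κ → E} (hv : LinearIndependent ℝ v) (a : κ)
    [(Submodule.span ℝ (v '' {a}ᶜ)).HasOrthogonalProjection] :
    (gram ℝ v)⁻¹ a a = (‖(Submodule.span ℝ (v '' {a}ᶜ))ᗮ.starProjection (v a)‖ ^ 2)⁻¹ := by
  set K := Submodule.span ℝ (v '' {a}ᶜ)
  set d := (gram ℝ v)⁻¹ a a
  set u := ∑ j, (gram ℝ v)⁻¹ j a • v j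
  have hvu (b : κ) : ⟪v b, u⟫_ℝ = (1 : Matrix κ κ ℝ) b a := inner_sum_inv_gram_smul hv a b
  have hd : 0 < d := (posDef_gram_of_linearIndependent hv).inv.diag_pos
  have huK : u ∈ Kᗮ := by
    suffices h : K ≤ (Submodule.span ℝ {u})ᗮ from (K.mem_orthogonal u).2 fun x hx =>
      Submodule.mem_orthogonal_singleton_iff_inner_left.1 (h hx)
    refine Submodule.span_le.2 ?_
    rintro _ ⟨j, hj, rfl⟩
    exact Submodule.mem_orthogonal_singleton_iff_inner_left.2 ((hvu j).trans (one_apply_ne hj))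
  have hproj : Kᗮ.starProjection u = d • Kᗮ.starProjection (v a) := by
    simp only [u, map_sum, map_smul]
    refine Finset.sum_eq_single a (fun j _ hj => ?_) (by simp)
    have hj : v j ∈ Kᗮᗮ := K.le_orthogonal_orthogonal (Submodule.subset_span ⟨j, hj, rfl⟩)
    rw [(Submodule.starProjection_apply_eq_zero_iff _).2 hj, smul_zero]
  have hnorm : ‖u‖ ^ 2 = d := by
    rw [← real_inner_self_eq_norm_sq]
    nth_rewrite 1 [show u = ∑ j, (gram ℝ v)⁻¹ j a • v j from rfl]
    simp only [sum_inner, inner_smul_left, hvu, Matrix.one_apply]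
    simp [d]
  rw [Submodule.starProjection_eq_self_iff.2 huK] at hproj
  rw [hproj, norm_smul, mul_pow, Real.norm_eq_abs, sq_abs] at hnorm
  refine eq_inv_of_mul_eq_one_right (mul_left_cancel₀ hd.ne' ?_)
  linear_combination hnorm

end Gram

section InverseGram

variable {κ E : Type*} [Fintype κ] [DecidableEq κ] [NormedAddCommGroup E] [InnerProductSpace ℝ E]
  [FiniteDimensional ℝ E] [MeasurableSpace E] [BorelSpace E]

theorem measurable_inv_gram_apply (a b : κ) :
    Measurable fun v : κ → E => (gram ℝ v)⁻¹ a b := by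
  have hgram : Continuous fun v : κ → E => gram ℝ v := by
    refine continuous_pi fun i => continuous_pi fun j => ?_
    simp only [gram_apply]
    fun_prop
  simp only [inv_def, Matrix.smul_apply, smul_eq_mul, Ring.inverse_eq_inv']
  exact hgram.matrix_det.measurable.inv.mul (hgram.matrix_adjugate.matrix_elem a b).measurable

theorem lintegral_inv_gram_apply_self {q : ℕ} (hq : q + 1 ≤ finrank ℝ E)
    (μ : Fin (q + 1) → Measure E) [∀ j, SigmaFinite (μ j)]
    (hμ : ∀ j (K : Submodule ℝ E), K ≠ ⊤ → μ j (K : Set E) = 0) (a : Fin (q + 1)) :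
    ∫⁻ v, ENNReal.ofReal ((gram ℝ v)⁻¹ a a) ∂Measure.pi μ =
      ∫⁻ v, ∫⁻ x, (ENNReal.ofReal (‖(Submodule.span ℝ (range v))ᗮ.starProjection x‖ ^ 2))⁻¹
        ∂μ a ∂Measure.pi fun j => μ (a.succAbove j) := by
  have hins := measurePreserving_insertNth μ a
  have hmeas : Measurable fun v : Fin (q + 1) → E => ENNReal.ofReal ((gram ℝ v)⁻¹ a a) :=
    (measurable_inv_gram_apply a a).ennreal_ofReal
  refine (hins.lintegral_comp hmeas).symm.trans
    ((lintegral_prod _ (hmeas.comp hins.measurable).aemeasurable).trans ?_)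
  have hae := Measure.ae_ae_of_ae_prod
    (hins.quasiMeasurePreserving.ae (ae_linearIndependent_pi hq μ hμ))
  refine lintegral_congr_ae (hae.mono fun v hv => lintegral_congr_ae (hv.mono fun x hx => ?_))
  have himage : (a.insertNth x v : Fin (q + 1) → E) '' {a}ᶜ = range v := by
    rw [← Fin.range_succAbove, ← range_comp]
    congr 1
    ext j
    simp
  have hpos := (posDef_gram_of_linearIndependent hx).inv.diag_pos (i := a)
  have hinv := inv_gram_apply_self hx a
  simp only [himage, Fin.insertNth_apply_same] at hinv
  rw [hinv] at hpos
  simp only [Function.comp_apply, hinv, ENNReal.ofReal_inv_of_pos (inv_pos.1 hpos)]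

end InverseGram

section GaussianGram

variable {ι : Type*} [Fintype ι] {q : ℕ}

theorem finrank_orthogonal_span_range {v : Fin q → EuclideanSpace ℝ ι}
    (hv : LinearIndependent ℝ v) :
    q + finrank ℝ (Submodule.span ℝ (range v))ᗮ = Fintype.card ι := by
  rw [← finrank_euclideanSpace (𝕜 := ℝ),
    ← (Submodule.span ℝ (range v)).finrank_add_finrank_orthogonal, finrank_span_eq_card hv,
    Fintype.card_fin]

variable [DecidableEq ι]

theorem ae_linearIndependent_pi_multivariateGaussian (hq : q ≤ Fintype.card ι)
    (m : Fin q → EuclideanSpace ℝ ι) :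
    ∀ᵐ v ∂Measure.pi fun j => multivariateGaussian (m j) 1, LinearIndependent ℝ v :=
  ae_linearIndependent_pi (by simpa using hq) _ fun _ _ => multivariateGaussian_submodule .one _

theorem lintegral_inv_gram_pi_multivariateGaussian (hq : q + 1 ≤ Fintype.card ι)
    (m : Fin (q + 1) → EuclideanSpace ℝ ι) (a : Fin (q + 1)) :
    ∫⁻ v, ENNReal.ofReal ((gram ℝ v)⁻¹ a a) ∂Measure.pi (fun j => multivariateGaussian (m j) 1) =
      ∫⁻ v, ∫⁻ x, (ENNReal.ofReal (‖(Submodule.span ℝ (range v))ᗮ.starProjection x‖ ^ 2))⁻¹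
        ∂multivariateGaussian (m a) 1
        ∂Measure.pi fun j => multivariateGaussian (m (a.succAbove j)) 1 :=
  lintegral_inv_gram_apply_self (by simpa using hq) _
    (fun _ _ => multivariateGaussian_submodule .one _) a

theorem lintegral_inv_gram_multivariateGaussian_le (hq : q + 1 < Fintype.card ι)
    (m : Fin q → EuclideanSpace ℝ ι) (a : Fin q) :
    ∫⁻ v, ENNReal.ofReal ((gram ℝ v)⁻¹ a a) ∂Measure.pi (fun j => multivariateGaussian (m j) 1) ≤
      ENNReal.ofReal ((Fintype.card ι - q - 1 : ℝ)⁻¹) := by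
  cases q with
  | zero => exact a.elim0
  | succ q =>
    rw [lintegral_inv_gram_pi_multivariateGaussian (by omega)]
    refine (lintegral_mono_ae (g := fun _ =>
      ENNReal.ofReal ((Fintype.card ι - ↑(q + 1) - 1 : ℝ)⁻¹)) ?_).trans_eq (by simp)
    filter_upwards [ae_linearIndependent_pi_multivariateGaussian (by omega)
      fun j => m (a.succAbove j)] with v hv
    have hrank := finrank_orthogonal_span_range hv
    convert lintegral_inv_norm_sq_starProjection_le (K := (Submodule.span ℝ (range v))ᗮ)
      (by omega) (m a) using 3
    rw [← hrank]
    push_cast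
    ring

theorem lintegral_inv_gram_multivariateGaussian_of_eq_zero (hq : q + 1 < Fintype.card ι)
    (m : Fin q → EuclideanSpace ℝ ι) {a : Fin q} (ha : m a = 0) :
    ∫⁻ v, ENNReal.ofReal ((gram ℝ v)⁻¹ a a) ∂Measure.pi (fun j => multivariateGaussian (m j) 1) =
      ENNReal.ofReal ((Fintype.card ι - q - 1 : ℝ)⁻¹) := by
  cases q with
  | zero => exact a.elim0
  | succ q =>
    rw [lintegral_inv_gram_pi_multivariateGaussian (by omega), ha]
    refine (lintegral_congr_ae (g := fun _ =>
      ENNReal.ofReal ((Fintype.card ι - ↑(q + 1) - 1 : ℝ)⁻¹)) ?_).trans (by simp)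
    filter_upwards [ae_linearIndependent_pi_multivariateGaussian (by omega)
      fun j => m (a.succAbove j)] with v hv
    have hrank := finrank_orthogonal_span_range hv
    convert lintegral_inv_norm_sq_starProjection_zero (K := (Submodule.span ℝ (range v))ᗮ)
      (by omega) using 3
    rw [← hrank]
    push_cast
    ring

end GaussianGram

section Columns

variable {m κ : Type*}

/-- The columns of a matrix as vectors of a Euclidean space, so that `Yᵀ * Y` is their Gram
matrix. -/
def columns (Y : Matrix m κ ℝ) : κ → EuclideanSpace ℝ m :=
  fun j => toLp 2 (Y.col j)

/-- The matrix with given columns, inverse to `columns`. -/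
def ofColumns (v : κ → EuclideanSpace ℝ m) : Matrix m κ ℝ :=
  of fun i j => v j i

theorem columns_ofColumns (v : κ → EuclideanSpace ℝ m) : columns (ofColumns v) = v :=
  rfl

theorem gram_columns [Fintype m] (Y : Matrix m κ ℝ) : gram ℝ (columns Y) = Yᵀ * Y := by
  ext i j
  simp [columns, Matrix.mul_apply, PiLp.inner_apply, mul_comm]

end Columns

section Observation

variable {Ω : Type*} [MeasurableSpace Ω] {P : Measure Ω} {n p : ℕ}
  {M : Matrix (Fin n) (Fin p) ℝ} {X : Ω → Matrix (Fin n) (Fin p) ℝ}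

theorem IsNormalMatrixObservation.hasLaw_vec (hX : IsNormalMatrixObservation P M X) :
    HasLaw (fun ω => vec (X ω)) (Measure.pi fun ji => gaussianReal (vec M ji) 1) P :=
  (hX.indep.precomp (Prod.swap_injective (α := Fin p) (β := Fin n))).hasLaw_pi
    fun ji => hX.hasLaw ji.2 ji.1

theorem isNormalMatrixObservation_of_hasLaw_vec [IsProbabilityMeasure P]
    (hX : HasLaw (fun ω => vec (X ω)) (Measure.pi fun ji => gaussianReal (vec M ji) 1) P) :
    IsNormalMatrixObservation P M X := by
  have hentry (ji : Fin p × Fin n) :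
      HasLaw (fun ω => vec (X ω) ji) (gaussianReal (vec M ji) 1) P :=
    (measurePreserving_eval _ ji).fun_comp_hasLaw hX
  exact ⟨fun i j => hentry (j, i),
    ((iIndepFun_iff_hasLaw_pi_pi hentry).2 hX).precomp Prod.swap_injective⟩

theorem IsNormalMatrixObservation.mul_mul [IsProbabilityMeasure P]
    (hX : IsNormalMatrixObservation P M X) {O : Matrix (Fin n) (Fin n) ℝ}
    {Q : Matrix (Fin p) (Fin p) ℝ} (hO : O ∈ orthogonalGroup (Fin n) ℝ)
    (hQ : Q ∈ orthogonalGroup (Fin p) ℝ) :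
    IsNormalMatrixObservation P (O * M * Q) fun ω => O * X ω * Q := by
  have hvec (Y : Matrix (Fin n) (Fin p) ℝ) : (Qᵀ ⊗ₖ O) *ᵥ vec Y = vec (O * Y * Q) := by
    rw [kronecker_mulVec_vec, transpose_transpose]
  have hrot := (measurePreserving_mulVec_pi_gaussianReal
    (kronecker_mem_unitary (Unitary.star_mem hQ) hO) (vec M)).fun_comp_hasLaw hX.hasLaw_vec
  refine isNormalMatrixObservation_of_hasLaw_vec ?_
  simp only [← hvec]
  exact hrot

theorem IsNormalMatrixObservation.hasLaw_columns (hX : IsNormalMatrixObservation P M X) :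
    HasLaw (fun ω => columns (X ω)) (Measure.pi fun j => multivariateGaussian (columns M j) 1)
      P := by
  have hcurry : MeasurePreserving (MeasurableEquiv.curry (Fin p) (Fin n) ℝ)
      (Measure.pi fun ji => gaussianReal (M ji.2 ji.1) 1)
      (Measure.pi fun j => Measure.pi fun i => gaussianReal (M i j) 1) := by
    refine ⟨MeasurableEquiv.measurable _, ?_⟩
    simpa only [Measure.infinitePi_eq_pi] using
      Measure.infinitePi_map_curry fun (j : Fin p) (i : Fin n) => gaussianReal (M i j) 1
  have htoLp := measurePreserving_pi _ _ fun j =>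
    (⟨by fun_prop, map_pi_gaussianReal_toLp (M.col j)⟩ : MeasurePreserving (toLp 2)
      (Measure.pi fun i => gaussianReal (M i j) 1) (multivariateGaussian (columns M j) 1))
  exact htoLp.fun_comp_hasLaw (hcurry.fun_comp_hasLaw hX.hasLaw_vec)

end Observation

section TransposeMulSelf

variable {m κ ι R : Type*} [Fintype m] [Fintype κ] [CommRing R]

theorem transpose_mul_self_mul_mul {l : Type*} [Fintype l] [DecidableEq m] {O : Matrix l m R}
    (hO : Oᵀ * O = 1) (Q : Matrix κ ι R) (Y : Matrix m κ R) :
    (O * Y * Q)ᵀ * (O * Y * Q) = Qᵀ * (Yᵀ * Y) * Q := by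
  calc (O * Y * Q)ᵀ * (O * Y * Q) = Qᵀ * (Yᵀ * (Oᵀ * O) * Y) * Q := by
        simp only [transpose_mul, Matrix.mul_assoc]
    _ = Qᵀ * (Yᵀ * Y) * Q := by rw [hO, Matrix.mul_one]

theorem transpose_mul_self_mul_inv [DecidableEq κ] (Y : Matrix m κ R) :
    (Y * (Yᵀ * Y)⁻¹)ᵀ * (Y * (Yᵀ * Y)⁻¹) = (Yᵀ * Y)⁻¹ := by
  have hassoc : (Y * (Yᵀ * Y)⁻¹)ᵀ * (Y * (Yᵀ * Y)⁻¹) = (Yᵀ * Y)⁻¹ * (Yᵀ * Y) * (Yᵀ * Y)⁻¹ := by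
    simp only [transpose_mul, transpose_nonsing_inv, transpose_transpose, Matrix.mul_assoc]
  rw [hassoc]
  by_cases hdet : IsUnit (Yᵀ * Y).det
  · rw [nonsing_inv_mul _ hdet, Matrix.one_mul]
  · rw [nonsing_inv_apply_not_isUnit _ hdet, Matrix.mul_zero]

theorem inv_transpose_mul_self_apply_self_nonneg [DecidableEq κ] (Y : Matrix m κ ℝ) (a : κ) :
    0 ≤ (Yᵀ * Y)⁻¹ a a :=
  (posSemidef_conjTranspose_mul_self Y).inv.diag_nonneg

theorem mul_inv_apply_sq_le [DecidableEq κ] (Y : Matrix m κ ℝ) (i : m) (a : κ) :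
    (Y * (Yᵀ * Y)⁻¹) i a ^ 2 ≤ (Yᵀ * Y)⁻¹ a a := by
  calc (Y * (Yᵀ * Y)⁻¹) i a ^ 2 ≤ ∑ k, (Y * (Yᵀ * Y)⁻¹) k a ^ 2 :=
        Finset.single_le_sum (f := fun k => (Y * (Yᵀ * Y)⁻¹) k a ^ 2)
          (fun k _ => sq_nonneg _) (Finset.mem_univ i)
    _ = ((Y * (Yᵀ * Y)⁻¹)ᵀ * (Y * (Yᵀ * Y)⁻¹)) a a := by
        rw [Matrix.mul_apply]
        simp only [transpose_apply, sq]
    _ = (Yᵀ * Y)⁻¹ a a := by rw [transpose_mul_self_mul_inv]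

end TransposeMulSelf

section Loss

variable {n p : ℕ}

/-- Equivariance of an estimator of an `n × p` matrix under the rotations `Y ↦ O * Y * Q`. -/
def IsOrthogonallyEquivariant (δ : Matrix (Fin n) (Fin p) ℝ → Matrix (Fin n) (Fin p) ℝ) : Prop :=
  ∀ ⦃O⦄, O ∈ orthogonalGroup (Fin n) ℝ → ∀ ⦃Q⦄, Q ∈ orthogonalGroup (Fin p) ℝ →
    ∀ Y, δ (O * Y * Q) = O * δ Y * Q

theorem isOrthogonallyEquivariant_estimator :
    IsOrthogonallyEquivariant (estimator (n := n) (p := p)) := by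
  intro O hO Q hQ Y
  have hOO : Oᵀ * O = 1 := (mem_orthogonalGroup_iff' (Fin n) ℝ).1 hO
  have hQQ : Q * Qᵀ = 1 := (mem_orthogonalGroup_iff (Fin p) ℝ).1 hQ
  have hinv : (Qᵀ * (Yᵀ * Y) * Q)⁻¹ = Qᵀ * (Yᵀ * Y)⁻¹ * Q := by
    rw [Matrix.mul_inv_rev, Matrix.mul_inv_rev, inv_eq_right_inv hQQ, inv_eq_left_inv hQQ,
      Matrix.mul_assoc]
  have hmul : O * Y * Q * (Qᵀ * (Yᵀ * Y)⁻¹ * Q) = O * (Y * (Yᵀ * Y)⁻¹) * Q := by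
    calc O * Y * Q * (Qᵀ * (Yᵀ * Y)⁻¹ * Q) = O * Y * (Q * Qᵀ) * (Yᵀ * Y)⁻¹ * Q := by
          simp only [Matrix.mul_assoc]
      _ = O * (Y * (Yᵀ * Y)⁻¹) * Q := by rw [hQQ, Matrix.mul_one, Matrix.mul_assoc O]
  simp only [estimator, transpose_mul_self_mul_mul hOO, hinv, Matrix.mul_sub, Matrix.sub_mul,
    Matrix.mul_one, Matrix.mul_smul, Matrix.smul_mul, hmul]

theorem loss_mul_mul {k q : ℕ} {O : Matrix (Fin k) (Fin n) ℝ} (hO : Oᵀ * O = 1)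
    (Q : Matrix (Fin p) (Fin q) ℝ) (M M' : Matrix (Fin n) (Fin p) ℝ) :
    loss (O * M * Q) (O * M' * Q) = Qᵀ * loss M M' * Q := by
  rw [loss, ← Matrix.sub_mul, ← Matrix.mul_sub, transpose_mul_self_mul_mul hO, loss]

theorem loss_apply (M M' : Matrix (Fin n) (Fin p) ℝ) (a b : Fin p) :
    loss M M' a b = ∑ i, (M' i a - M i a) * (M' i b - M i b) := by
  simp only [loss, Matrix.mul_apply, transpose_apply, Matrix.sub_apply]

theorem estimator_eq_sub (Y : Matrix (Fin n) (Fin p) ℝ) :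
    estimator Y = Y - ((n : ℝ) - p - 1) • (Y * (Yᵀ * Y)⁻¹) := by
  rw [estimator, Matrix.mul_sub, Matrix.mul_one, Matrix.mul_smul]

theorem loss_apply_self_of_eq_zero {M : Matrix (Fin n) (Fin p) ℝ} {a : Fin p} (ha : M.col a = 0)
    (M' : Matrix (Fin n) (Fin p) ℝ) : loss M M' a a = loss 0 M' a a := by
  have hentry (i : Fin n) : M i a = 0 := congrFun ha i
  simp only [loss_apply, hentry, Matrix.zero_apply]

theorem loss_zero_estimator {Y : Matrix (Fin n) (Fin p) ℝ} (hdet : IsUnit (Yᵀ * Y).det) :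
    loss 0 (estimator Y) = Yᵀ * Y - (2 * ((n : ℝ) - p - 1)) • (1 : Matrix (Fin p) (Fin p) ℝ) +
      ((n : ℝ) - p - 1) ^ 2 • (Yᵀ * Y)⁻¹ := by
  have hright : Yᵀ * (Y * (Yᵀ * Y)⁻¹) = 1 := by rw [← Matrix.mul_assoc, mul_nonsing_inv _ hdet]
  have hleft : (Y * (Yᵀ * Y)⁻¹)ᵀ * Y = 1 := by
    rw [← transpose_one, ← hright, transpose_mul Yᵀ, transpose_transpose]
  rw [loss, sub_zero, estimator_eq_sub, transpose_sub, transpose_smul]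
  simp only [Matrix.sub_mul, Matrix.mul_sub, Matrix.smul_mul, Matrix.mul_smul, hright, hleft,
    transpose_mul_self_mul_inv]
  module

end Loss

section Risk

variable {Ω : Type*} [MeasurableSpace Ω] {P : Measure Ω} {n p : ℕ}
  {M : Matrix (Fin n) (Fin p) ℝ} {X : Ω → Matrix (Fin n) (Fin p) ℝ}
  {δ : Matrix (Fin n) (Fin p) ℝ → Matrix (Fin n) (Fin p) ℝ}

theorem risk_mul_mul (hδ : IsOrthogonallyEquivariant δ)
    (hint : ∀ a b, Integrable (fun ω => loss M (δ (X ω)) a b) P)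
    {O : Matrix (Fin n) (Fin n) ℝ} (hO : O ∈ orthogonalGroup (Fin n) ℝ)
    {Q : Matrix (Fin p) (Fin p) ℝ} (hQ : Q ∈ orthogonalGroup (Fin p) ℝ) :
    risk P (O * M * Q) (fun ω => O * X ω * Q) δ = Qᵀ * risk P M X δ * Q := by
  have hOO : Oᵀ * O = 1 := (mem_orthogonalGroup_iff' (Fin n) ℝ).1 hO
  ext a b
  simp only [risk, of_apply, hδ hO hQ, loss_mul_mul hOO, Matrix.mul_apply]
  rw [integral_finsetSum _ fun j _ => (integrable_finsetSum _ fun i _ =>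
    (hint i j).const_mul _).mul_const _]
  refine Finset.sum_congr rfl fun j _ => ?_
  rw [integral_mul_const, integral_finsetSum _ fun i _ => (hint i j).const_mul _]
  simp only [integral_const_mul]

theorem IsNormalMatrixObservation.risk_eq {Ω' : Type*} [MeasurableSpace Ω'] {P' : Measure Ω'}
    {X' : Ω' → Matrix (Fin n) (Fin p) ℝ} (hX : IsNormalMatrixObservation P M X)
    (hX' : IsNormalMatrixObservation P' M X')
    (hδ : ∀ i a, Measurable fun v : Fin p → EuclideanSpace ℝ (Fin n) => δ (ofColumns v) i a) :
    risk P M X δ = risk P' M X' δ := by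
  ext a b
  have hloss : Measurable fun v => loss M (δ (ofColumns v)) a b := by
    simp only [loss_apply]
    exact Finset.measurable_fun_sum _ fun i _ =>
      ((hδ i a).sub_const _).mul ((hδ i b).sub_const _)
  exact (hX.hasLaw_columns.integral_comp hloss.aestronglyMeasurable).trans
    (hX'.hasLaw_columns.integral_comp hloss.aestronglyMeasurable).symm

theorem measurable_estimator_ofColumns (i : Fin n) (a : Fin p) :
    Measurable fun v : Fin p → EuclideanSpace ℝ (Fin n) => estimator (ofColumns v) i a := by
  have hentry (j : Fin p) :
      Measurable fun v : Fin p → EuclideanSpace ℝ (Fin n) => ofColumns v i j := by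
    simp only [ofColumns, of_apply]
    fun_prop
  have hinv (j : Fin p) : Measurable fun v : Fin p → EuclideanSpace ℝ (Fin n) =>
      ((ofColumns v)ᵀ * ofColumns v)⁻¹ j a := by
    simp only [← gram_columns, columns_ofColumns]
    exact measurable_inv_gram_apply j a
  simp only [estimator_eq_sub, Matrix.sub_apply, Matrix.smul_apply, smul_eq_mul,
    Matrix.mul_apply (M := ofColumns _)]
  exact (hentry a).sub
    ((Finset.measurable_fun_sum _ fun j _ => (hentry j).mul (hinv j)).const_mul _)

namespace IsNormalMatrixObservation

theorem ae_isUnit_det_transpose_mul_self (hX : IsNormalMatrixObservation P M X) (hpn : p ≤ n) :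
    ∀ᵐ ω ∂P, IsUnit ((X ω)ᵀ * X ω).det := by
  have hli := ae_linearIndependent_pi_multivariateGaussian (by simpa using hpn) (columns M)
  rw [← hX.hasLaw_columns.map_eq] at hli
  filter_upwards [ae_of_ae_map hX.hasLaw_columns.aemeasurable hli] with ω hω
  rw [← gram_columns]
  exact (det_gram_ne_zero_iff_linearIndependent.2 hω).isUnit

theorem aemeasurable_inv_transpose_mul_self (hX : IsNormalMatrixObservation P M X)
    (a b : Fin p) : AEMeasurable (fun ω => ((X ω)ᵀ * X ω)⁻¹ a b) P := by
  simp only [← gram_columns]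
  exact (measurable_inv_gram_apply a b).comp_aemeasurable hX.hasLaw_columns.aemeasurable

theorem lintegral_inv_transpose_mul_self (hX : IsNormalMatrixObservation P M X) (a : Fin p) :
    ∫⁻ ω, ENNReal.ofReal (((X ω)ᵀ * X ω)⁻¹ a a) ∂P =
      ∫⁻ v, ENNReal.ofReal ((gram ℝ v)⁻¹ a a)
        ∂Measure.pi fun j => multivariateGaussian (columns M j) 1 := by
  simp only [← gram_columns]
  exact hX.hasLaw_columns.lintegral_comp
    (measurable_inv_gram_apply a a).ennreal_ofReal.aemeasurable

theorem integrable_inv_transpose_mul_self (hX : IsNormalMatrixObservation P M X)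
    (hnp : p + 1 < n) (a : Fin p) : Integrable (fun ω => ((X ω)ᵀ * X ω)⁻¹ a a) P := by
  refine (lintegral_ofReal_ne_top_iff_integrable
    (hX.aemeasurable_inv_transpose_mul_self a a).aestronglyMeasurable
    (.of_forall fun ω => inv_transpose_mul_self_apply_self_nonneg _ a)).1 ?_
  rw [hX.lintegral_inv_transpose_mul_self]
  exact ((lintegral_inv_gram_multivariateGaussian_le (by simpa using hnp) _ a).trans_lt
    ENNReal.ofReal_lt_top).ne

theorem integral_inv_transpose_mul_self_of_eq_zero (hX : IsNormalMatrixObservation P M X)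
    (hnp : p + 1 < n) {a : Fin p} (ha : M.col a = 0) :
    ∫ ω, ((X ω)ᵀ * X ω)⁻¹ a a ∂P = ((n : ℝ) - p - 1)⁻¹ := by
  have hpos : 0 ≤ (n : ℝ) - p - 1 := by
    have : (p : ℝ) + 1 < n := by exact_mod_cast hnp
    linarith
  have hcol : columns M a = 0 := congrArg (toLp 2) ha
  rw [integral_eq_lintegral_of_nonneg_ae
    (.of_forall fun ω => inv_transpose_mul_self_apply_self_nonneg _ a)
    (hX.aemeasurable_inv_transpose_mul_self a a).aestronglyMeasurable,
    hX.lintegral_inv_transpose_mul_self,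
    lintegral_inv_gram_multivariateGaussian_of_eq_zero (by simpa using hnp) _ hcol,
    Fintype.card_fin, ENNReal.toReal_ofReal (inv_nonneg.2 hpos)]

theorem memLp_apply (hX : IsNormalMatrixObservation P M X) (i : Fin n) (a : Fin p) :
    MemLp (fun ω => X ω i a) 2 P := by
  have hid := memLp_id_gaussianReal' (μ := M i a) (v := 1) 2 (by simp)
  rw [← (hX.hasLaw i a).map_eq] at hid
  exact hid.comp_of_map (hX.hasLaw i a).aemeasurable

theorem memLp_estimator (hX : IsNormalMatrixObservation P M X)
    (hnp : p + 1 < n) (i : Fin n) (a : Fin p) : MemLp (fun ω => estimator (X ω) i a) 2 P := by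
  have hmeas : AEMeasurable (fun ω => (X ω * ((X ω)ᵀ * X ω)⁻¹) i a) P := by
    have hentry (j : Fin p) : AEMeasurable (fun ω => X ω i j) P := (hX.hasLaw i j).aemeasurable
    have hinv (j : Fin p) := hX.aemeasurable_inv_transpose_mul_self j a
    simp only [Matrix.mul_apply (M := X _)]
    exact Finset.aemeasurable_fun_sum _ fun j _ => (hentry j).mul (hinv j)
  have hmul : MemLp (fun ω => (X ω * ((X ω)ᵀ * X ω)⁻¹) i a) 2 P := by
    refine (memLp_two_iff_integrable_sq hmeas.aestronglyMeasurable).2 <|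
      (hX.integrable_inv_transpose_mul_self hnp a).mono'
        (hmeas.pow_const 2).aestronglyMeasurable (.of_forall fun ω => ?_)
    rw [Real.norm_of_nonneg (sq_nonneg _)]
    exact mul_inv_apply_sq_le _ i a
  simp only [estimator_eq_sub]
  exact (hX.memLp_apply i a).sub (hmul.const_mul _)

theorem integral_transpose_mul_self_apply_self [IsProbabilityMeasure P]
    (hX : IsNormalMatrixObservation P M X) (a : Fin p) :
    ∫ ω, ((X ω)ᵀ * X ω) a a ∂P = (Mᵀ * M) a a + n := by
  have hsq (i : Fin n) : ∫ ω, X ω i a ^ 2 ∂P = M i a ^ 2 + 1 := by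
    have hvar := (variance_eq_sub (hX.memLp_apply i a)).symm.trans (hX.hasLaw i a).variance_eq
    rw [(hX.hasLaw i a).integral_eq, integral_id_gaussianReal, variance_id_gaussianReal,
      NNReal.coe_one, sub_eq_iff_eq_add'] at hvar
    exact hvar
  simp only [Matrix.mul_apply, transpose_apply, ← sq]
  rw [integral_finsetSum _ fun i _ => (hX.memLp_apply i a).integrable_sq]
  simp [hsq, Finset.sum_add_distrib]

variable [IsProbabilityMeasure P]

theorem integrable_loss_estimator (hX : IsNormalMatrixObservation P M X) (hnp : p + 1 < n)
    (a b : Fin p) : Integrable (fun ω => loss M (estimator (X ω)) a b) P := by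
  have herror (i : Fin n) (a : Fin p) : MemLp (fun ω => estimator (X ω) i a - M i a) 2 P :=
    (hX.memLp_estimator hnp i a).sub (memLp_const _)
  simp only [loss_apply]
  exact integrable_finsetSum _ fun i _ => (herror i a).integrable_mul (herror i b)

theorem risk_estimator_apply_self_of_eq_zero (hX : IsNormalMatrixObservation P M X)
    (hnp : p + 1 < n) {a : Fin p} (ha : M.col a = 0) :
    risk P M X estimator a a = (p : ℝ) + 1 := by
  have hpos : (n : ℝ) - p - 1 ≠ 0 := by
    have : (p : ℝ) + 1 < n := by exact_mod_cast hnp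
    linarith
  set c : ℝ := (n : ℝ) - p - 1 with hc
  have hloss : (fun ω => loss M (estimator (X ω)) a a) =ᵐ[P]
      fun ω => (((X ω)ᵀ * X ω) a a - 2 * c) + c ^ 2 * ((X ω)ᵀ * X ω)⁻¹ a a := by
    filter_upwards [hX.ae_isUnit_det_transpose_mul_self (by lia)] with ω hdet
    rw [loss_apply_self_of_eq_zero ha, loss_zero_estimator hdet]
    simp [hc]
  have hMM : (Mᵀ * M) a a = 0 := by
    have hentry (i : Fin n) : M i a = 0 := congrFun ha i
    simp only [Matrix.mul_apply, hentry, mul_zero, Finset.sum_const_zero]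
  have hquad : Integrable (fun ω => ((X ω)ᵀ * X ω) a a) P := by
    simp only [Matrix.mul_apply]
    exact integrable_finsetSum _ fun i _ => (hX.memLp_apply i a).integrable_mul (hX.memLp_apply i a)
  calc risk P M X estimator a a
      = ∫ ω, ((((X ω)ᵀ * X ω) a a - 2 * c) + c ^ 2 * ((X ω)ᵀ * X ω)⁻¹ a a) ∂P :=
        integral_congr_ae hloss
    _ = ((n : ℝ) - 2 * c) + c ^ 2 * c⁻¹ := by
        rw [integral_add (by exact hquad.sub (integrable_const _))
          ((hX.integrable_inv_transpose_mul_self hnp a).const_mul _),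
          integral_sub hquad (integrable_const _), integral_const_mul (c ^ 2),
          hX.integral_transpose_mul_self_apply_self,
          hX.integral_inv_transpose_mul_self_of_eq_zero hnp ha,
          ← hc, hMM, zero_add, integral_const, probReal_univ, one_smul]
    _ = (p : ℝ) + 1 := by
        rw [pow_two, mul_assoc, mul_inv_cancel₀ hpos]
        linarith

end IsNormalMatrixObservation

end Risk

section Householder

variable {m K : Type*} [Fintype m] [DecidableEq m] [Field K]

/-- The matrix of the reflection in the hyperplane orthogonal to `w`. Since `2 / 0 = 0`, it is the
identity for `w = 0`. -/
def householder (w : m → K) : Matrix m m K :=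
  1 - (2 / (w ⬝ᵥ w)) • vecMulVec w w

theorem householder_zero : householder (0 : m → K) = 1 := by
  rw [householder, zero_vecMulVec, smul_zero, sub_zero]

theorem transpose_householder (w : m → K) : (householder w)ᵀ = householder w := by
  rw [householder, transpose_sub, transpose_one, transpose_smul, transpose_vecMulVec]

theorem householder_mulVec (w x : m → K) :
    householder w *ᵥ x = x - (2 / (w ⬝ᵥ w) * (w ⬝ᵥ x)) • w := by
  rw [householder, sub_mulVec, one_mulVec, smul_mulVec, vecMulVec_mulVec, op_smul_eq_smul,
    smul_smul]

theorem eq_smul_of_householder_mulVec_eq_neg [NeZero (2 : K)] {w y : m → K}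
    (h : householder w *ᵥ y = -y) : y = (w ⬝ᵥ y / (w ⬝ᵥ w)) • w := by
  rw [householder_mulVec, sub_eq_iff_eq_add, eq_neg_add_iff_add_eq, ← two_smul K] at h
  refine smul_right_injective _ (two_ne_zero' K) ?_
  simp only [h, smul_smul]
  congr 1
  ring

variable [LinearOrder K] [IsStrictOrderedRing K]

theorem householder_mul_self (w : m → K) : householder w * householder w = 1 := by
  rcases eq_or_ne w 0 with rfl | hw
  · rw [householder_zero, Matrix.one_mul]
  have hww : w ⬝ᵥ w ≠ 0 := mt dotProduct_self_eq_zero.1 hw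
  have hsq : vecMulVec w w * vecMulVec w w = (w ⬝ᵥ w) • vecMulVec w w := by
    rw [vecMulVec_mul_vecMulVec, vecMulVec_smul]
  simp only [householder, Matrix.mul_sub, Matrix.sub_mul, Matrix.mul_one, Matrix.one_mul,
    Matrix.mul_smul, Matrix.smul_mul, hsq, smul_smul, div_mul_cancel₀ _ hww]
  module

theorem householder_mem_orthogonalGroup (w : m → K) : householder w ∈ orthogonalGroup m K := by
  rw [mem_orthogonalGroup_iff, transpose_householder, householder_mul_self]

theorem householder_mulVec_self {w : m → K} (hw : w ≠ 0) : householder w *ᵥ w = -w := by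
  rw [householder_mulVec, div_mul_cancel₀ _ (mt dotProduct_self_eq_zero.1 hw)]
  module

theorem householder_sub_mulVec {x y : m → K} (h : x ⬝ᵥ x = y ⬝ᵥ y) :
    householder (x - y) *ᵥ y = x := by
  rcases eq_or_ne x y with rfl | hxy
  · rw [sub_self, householder_zero, one_mulVec]
  have hne : (x - y) ⬝ᵥ (x - y) ≠ 0 := mt dotProduct_self_eq_zero.1 (sub_ne_zero.2 hxy)
  have hdot : 2 * ((x - y) ⬝ᵥ y) = -((x - y) ⬝ᵥ (x - y)) := by
    simp only [sub_dotProduct, dotProduct_sub, h, dotProduct_comm y x]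
    ring
  rw [householder_mulVec, div_mul_eq_mul_div, hdot, neg_div, div_self hne]
  module

theorem householder_mul_mul_householder {l : Type*} [Fintype l] [DecidableEq l]
    {A : Matrix l m K} {u : m → K} {c : K} (h : (Aᵀ * A) *ᵥ u = c • u) :
    householder (A *ᵥ u) * A * householder u = A := by
  have hvec : (A *ᵥ u) ᵥ* A = c • u := by
    rw [← mulVec_transpose, mulVec_mulVec, h]
  have hdot : (A *ᵥ u) ⬝ᵥ (A *ᵥ u) = c * (u ⬝ᵥ u) := by
    rw [dotProduct_mulVec, hvec, smul_dotProduct, smul_eq_mul]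
  have hcomm : householder (A *ᵥ u) * A = A * householder u := by
    simp only [householder, Matrix.sub_mul, Matrix.mul_sub, Matrix.one_mul, Matrix.mul_one,
      Matrix.smul_mul, Matrix.mul_smul, vecMulVec_mul, mul_vecMulVec, hvec, hdot]
    rcases eq_or_ne c 0 with rfl | hc
    · have hAu : A *ᵥ u = 0 := dotProduct_self_eq_zero.1 (by rw [hdot, zero_mul])
      simp [hAu]
    · rw [vecMulVec_smul, smul_smul, div_mul_eq_mul_div, mul_comm c, mul_div_mul_right _ _ hc]
  rw [hcomm, Matrix.mul_assoc, householder_mul_self, Matrix.mul_one]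

theorem exists_mulVec_eq_smul_of_householder_mul_mul {A : Matrix m m K} {u : m → K} (hu : u ≠ 0)
    (h : householder u * A * householder u = A) : ∃ r : K, A *ᵥ u = r • u := by
  refine ⟨_, eq_smul_of_householder_mulVec_eq_neg (w := u) ?_⟩
  calc householder u *ᵥ (A *ᵥ u)
      = -((householder u * A * householder u) *ᵥ u) := by
        rw [← mulVec_mulVec, householder_mulVec_self hu, mulVec_neg, neg_neg, mulVec_mulVec]
    _ = -(A *ᵥ u) := by rw [h]

end Householder

section OrthogonalDiagonalization

variable {ι R : Type*} [CommRing R] [Fintype ι] [DecidableEq ι] {U : Matrix ι ι R}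

theorem row_ne_zero_of_mem_orthogonalGroup [Nontrivial R] (hU : U ∈ orthogonalGroup ι R)
    (j : ι) : U j ≠ 0 := by
  intro hj
  have hUU : U * Uᵀ = 1 := (mem_orthogonalGroup_iff ι R).1 hU
  have hjj : U j ⬝ᵥ U j = 1 := (congrFun₂ hUU j j).trans (one_apply_eq j)
  rw [hj, zero_dotProduct] at hjj
  exact zero_ne_one hjj

theorem eq_transpose_mul_diagonal_mul_iff (hU : U ∈ orthogonalGroup ι R) {A : Matrix ι ι R}
    {d : ι → R} : A = Uᵀ * diagonal d * U ↔ ∀ j, A *ᵥ U j = d j • U j := by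
  have hUU : U * Uᵀ = 1 := (mem_orthogonalGroup_iff ι R).1 hU
  have hUU' : Uᵀ * U = 1 := (mem_orthogonalGroup_iff' ι R).1 hU
  calc A = Uᵀ * diagonal d * U ↔ A * Uᵀ = Uᵀ * diagonal d := by
        constructor
        · rintro rfl
          rw [Matrix.mul_assoc, hUU, Matrix.mul_one]
        · intro h
          rw [← h, Matrix.mul_assoc, hUU', Matrix.mul_one]
    _ ↔ ∀ j, A *ᵥ U j = d j • U j := by
        simp only [← Matrix.ext_iff, funext_iff, mul_diagonal]
        rw [forall_comm]
        simp [Matrix.mul_apply, mulVec, dotProduct, mul_comm (d _)]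

end OrthogonalDiagonalization

namespace IsNormalMatrixObservation

variable {Ω : Type*} [MeasurableSpace Ω] {P : Measure Ω} [IsProbabilityMeasure P] {n p : ℕ}
  {M : Matrix (Fin n) (Fin p) ℝ} {X : Ω → Matrix (Fin n) (Fin p) ℝ}

theorem exists_risk_mulVec_eq_smul (hX : IsNormalMatrixObservation P M X)
    {δ : Matrix (Fin n) (Fin p) ℝ → Matrix (Fin n) (Fin p) ℝ}
    (hδ : IsOrthogonallyEquivariant δ)
    (hmeas : ∀ i a, Measurable fun v : Fin p → EuclideanSpace ℝ (Fin n) => δ (ofColumns v) i a)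
    (hint : ∀ a b, Integrable (fun ω => loss M (δ (X ω)) a b) P)
    {u : Fin p → ℝ} (hu : u ≠ 0) {l : ℝ} (h : (Mᵀ * M) *ᵥ u = l • u) :
    ∃ r : ℝ, risk P M X δ *ᵥ u = r • u := by
  have hO := householder_mem_orthogonalGroup (M *ᵥ u)
  have hQ := householder_mem_orthogonalGroup u
  have hM := householder_mul_mul_householder h
  have hX' := hX.mul_mul hO hQ
  have hrisk := risk_mul_mul hδ hint hO hQ
  rw [hM] at hX' hrisk
  rw [← hX.risk_eq hX' hmeas, transpose_householder] at hrisk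
  exact exists_mulVec_eq_smul_of_householder_mul_mul hu hrisk.symm

theorem dotProduct_risk_estimator_mulVec_of_mulVec_eq_zero (hX : IsNormalMatrixObservation P M X)
    (hnp : p + 1 < n) {u : Fin p → ℝ} (h : M *ᵥ u = 0) :
    u ⬝ᵥ (risk P M X estimator *ᵥ u) = ((p : ℝ) + 1) * (u ⬝ᵥ u) := by
  rcases eq_or_ne u 0 with rfl | hu
  · simp only [zero_dotProduct, mul_zero]
  obtain ⟨a, -⟩ := Function.ne_iff.1 hu
  set e : Fin p → ℝ := Pi.single a 1 with he
  set t : ℝ := √(u ⬝ᵥ u)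
  have htt : t * t = u ⬝ᵥ u := Real.mul_self_sqrt (dotProduct_self_star_nonneg u)
  have ht : t ≠ 0 := fun ht => hu (dotProduct_self_eq_zero.1 (by rw [← htt, ht, zero_mul]))
  have hQ := householder_mem_orthogonalGroup (u - t • e)
  have hQe : householder (u - t • e) *ᵥ (t • e) = u :=
    householder_sub_mulVec (by simp [he, htt])
  set Q := householder (u - t • e)
  have hcol : ((1 : Matrix (Fin n) (Fin n) ℝ) * M * Q).col a = 0 := by
    refine smul_right_injective _ ht ?_
    simp only [← mulVec_single_one, ← mulVec_smul, ← he, smul_zero]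
    rw [Matrix.one_mul, ← mulVec_mulVec, hQe, h]
  have hval := (hX.mul_mul (one_mem _) hQ).risk_estimator_apply_self_of_eq_zero hnp hcol
  rw [risk_mul_mul isOrthogonallyEquivariant_estimator (hX.integrable_loss_estimator hnp)
    (one_mem _) hQ] at hval
  calc u ⬝ᵥ (risk P M X estimator *ᵥ u)
      = (t • e) ⬝ᵥ ((Qᵀ * risk P M X estimator * Q) *ᵥ (t • e)) := by
        rw [← mulVec_mulVec, ← mulVec_mulVec, hQe, dotProduct_mulVec (t • e), vecMul_transpose,
          hQe]
    _ = t * t * (Qᵀ * risk P M X estimator * Q) a a := by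
        simp [he, mulVec_smul, mul_assoc]
    _ = ((p : ℝ) + 1) * (u ⬝ᵥ u) := by rw [hval, htt, mul_comm]

theorem exists_risk_estimator_mulVec_eq_smul (hX : IsNormalMatrixObservation P M X)
    (hnp : p + 1 < n) {u : Fin p → ℝ} (hu : u ≠ 0) {l : ℝ} (h : (Mᵀ * M) *ᵥ u = l • u) :
    ∃ r : ℝ, risk P M X estimator *ᵥ u = r • u ∧ (l = 0 → r = (p : ℝ) + 1) := by
  obtain ⟨r, hr⟩ := hX.exists_risk_mulVec_eq_smul isOrthogonallyEquivariant_estimator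
    measurable_estimator_ofColumns (hX.integrable_loss_estimator hnp) hu h
  refine ⟨r, hr, ?_⟩
  rintro rfl
  have hMu : M *ᵥ u = 0 := by
    rw [zero_smul, ← conjTranspose_eq_transpose_of_trivial] at h
    exact (conjTranspose_mul_self_mulVec_eq_zero M u).1 h
  have hval := hX.dotProduct_risk_estimator_mulVec_of_mulVec_eq_zero hnp hMu
  rw [hr, dotProduct_smul, smul_eq_mul] at hval
  exact mul_right_cancel₀ (mt dotProduct_self_eq_zero.1 hu) hval

end IsNormalMatrixObservation

end EfronMorris

theorem mainTheorem5 {Ω : Type*} [MeasurableSpace Ω] (P : Measure Ω) [IsProbabilityMeasure P]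
    {n p : ℕ} (hnp : p + 1 < n) (M : Matrix (Fin n) (Fin p) ℝ)
    (X : Ω → Matrix (Fin n) (Fin p) ℝ)
    (hX : EfronMorris.IsNormalMatrixObservation P M X) :
    -- the risk is finite
    (∀ a b, Integrable (fun ω => EfronMorris.loss M (EfronMorris.estimator (X ω)) a b) P) ∧
    -- every spectral decomposition of `MᵀM` diagonalizes the risk with the same eigenvectors,
    -- and the eigenvalue of the risk that corresponds to a zero eigenvalue of `MᵀM` is `p + 1`
    (∀ U ∈ Matrix.orthogonalGroup (Fin p) ℝ, ∀ l : Fin p → ℝ,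
      Mᵀ * M = Uᵀ * Matrix.diagonal l * U →
      ∃ r : Fin p → ℝ,
        EfronMorris.risk P M X EfronMorris.estimator = Uᵀ * Matrix.diagonal r * U ∧
        ∀ j, l j = 0 → r j = (p : ℝ) + 1) ∧
    -- the same for single eigenvectors
    (∀ (l : ℝ) (v : Fin p → ℝ),
      Module.End.HasEigenvector (Matrix.toLin' (Mᵀ * M)) l v →
      ∃ r : ℝ,
        Module.End.HasEigenvector
          (Matrix.toLin' (EfronMorris.risk P M X EfronMorris.estimator)) r v ∧
        (l = 0 → r = (p : ℝ) + 1)) := by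
  refine ⟨hX.integrable_loss_estimator hnp, fun U hU l hl => ?_, fun l v hv => ?_⟩
  · choose r hr hr0 using fun j => hX.exists_risk_estimator_mulVec_eq_smul hnp
      (EfronMorris.row_ne_zero_of_mem_orthogonalGroup hU j)
      ((EfronMorris.eq_transpose_mul_diagonal_mul_iff hU).1 hl j)
    exact ⟨r, (EfronMorris.eq_transpose_mul_diagonal_mul_iff hU).2 hr, hr0⟩
  · obtain ⟨r, hr, hr0⟩ := hX.exists_risk_estimator_mulVec_eq_smul hnp hv.2 hv.apply_eq_smul
    exact ⟨r, ⟨Module.End.mem_eigenspace_iff.2 hr, hv.2⟩, hr0⟩
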